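/- For $L\in\mathbb N=\{1,2,\dots\}$ and $l_0,\dots,l_L\in\mathbb N$, an artificial neural network (ANN) with layer dimensions $(l_0,\dots,l_L)$ is a tuple $\Phi=((W_1,B_1),\dots,(W_L,B_L))$ with $W_k\in\mathbb R^{l_k\times l_{k-1}}$ and $B_k\in\mathbb R^{l_k}$. Write $\mathbf N$ for the set of all ANNs, $\mathcal I(\Phi)=l_0$ and $\mathcal O(\Phi)=l_L$ for the input and output dimensions, $\mathcal P(\Phi)=\sum_{k=1}^L l_k(l_{k-1}+1)$ for the number of parameters, and $\mathcal H(\Phi)=L-1$ for the number of hidden layers. The (ReLU) realization $\mathcal R(\Phi)\colon\mathbb R^{l_0}\to\mathbb R^{l_L}$ is given by $(\mathcal R(\Phi))(x_0)=W_Lx_{L-1}+B_L$, where $x_k=\mathfrak M(W_kx_{k-1}+B_k)$ for $1\le k<L$ and $\mathfrak M$ applies $s\mapsto\max\{s,0\}$ in every coordinate. Let $\|\cdot\|$ denote the Euclidean norm. **Theorem.** Let $N,d\in\mathbb N$, $\mathfrak C\in[0,\infty)$, $T\in(0,\infty)$, $\varepsilon\in(0,1]$, $q\in(2,\infty)$,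 let $t_n=\frac{nT}{N}$ for $n\in\{0,1,\dots,N\}$, let $$\mathfrak D=\Big[\tfrac{720q}{q-2}\Big]\big[\log_2(\varepsilon^{-1})+q+1\big]-504,$$ and let $\Phi\in\mathbf N$ satisfy $\mathcal I(\Phi)=\mathcal O(\Phi)=d$ and $\|(\mathcal R(\Phi))(x)\|\le\mathfrak C(1+\|x\|)$ for all $x\in\mathbb R^d$. Let $Y=(Y^{x,y}_t)\colon[0,T]\times\mathbb R^d\times(\mathbb R^d)^N\to\mathbb R^d$ be the function which satisfies for all $n\in\{0,1,\dots,N-1\}$, $t\in[t_n,t_{n+1}]$, $x\in\mathbb R^d$, $y=(y_1,\dots,y_N)\in(\mathbb R^d)^N$ that $Y^{x,y}_0=x$ and $$Y^{x,y}_t=Y^{x,y}_{t_n}+\big(\tfrac{tN}{T}-n\big)\Big[\tfrac TN(\mathcal R(\Phi))\big(Y^{x,y}_{t_n}\big)+y_{n+1}\Big],$$ and for $n\in\{0,1,\dots,N\}$ let $$g_n(x,y)=\Big(\|x\|+\mathfrak Ct_n+\max_{m\in\{0,1,\dots,n\}}\Big\|\sum_{k=1}^m y_k\Big\|\Big)\exp(\mathfrak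 Ct_n).$$ Then there exist $\Psi_y\in\mathbf N$, $y\in(\mathbb R^d)^N$, such that 1. for all $y\in(\mathbb R^d)^N$, $\mathcal I(\Psi_y)=d+1$, $\mathcal O(\Psi_y)=d$, and $\mathcal R(\Psi_y)\colon\mathbb R^{d+1}\to\mathbb R^d$ is continuous; 2. for all $n\in\{0,\dots,N-1\}$, $t\in[t_n,t_{n+1}]$, $x\in\mathbb R^d$, $y\in(\mathbb R^d)^N$, $$\|Y^{x,y}_t-(\mathcal R(\Psi_y))(t,x)\|\le\varepsilon\big(2\sqrt d+(g_n(x,y))^q+(g_{n+1}(x,y))^q\big);$$ 3. for all $n\in\{0,\dots,N-1\}$, $t\in[t_n,t_{n+1}]$, $x\in\mathbb R^d$, $y\in(\mathbb R^d)^N$, $$\|(\mathcal R(\Psi_y))(t,x)\|\le 6\sqrt d+2\big((g_n(x,y))^2+(g_{n+1}(x,y))^2\big);$$ 4. for all $y\in(\mathbb R^d)^N$, $$\mathcal P(\Psi_y)\le\tfrac92N^6d^{16}\Big[2\mathcal H(\Phi)+\mathfrak D+\big(30+6\mathcal H(\Phi)+[4+\mathcal P(\Phi)]^2\big)^2\Big]^2;$$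 5. for all $t\in[0,T]$, $x\in\mathbb R^d$, the map $(\mathbb R^d)^N\ni y\mapsto(\mathcal R(\Psi_y))(t,x)\in\mathbb R^d$ is continuous; 6. for all $n\in\{0,1,\dots,N\}$, $t\in[0,t_n]$, $x\in\mathbb R^d$ and all $y,z\in(\mathbb R^d)^N$ with $y_k=z_k$ for every $k\in\{1,\dots,n\}$, $$(\mathcal R(\Psi_y))(t,x)=(\mathcal R(\Psi_z))(t,x).$$ -/

import Mathlib

noncomputable section

/-- The space `ℝ^d` with the Euclidean norm. -/
abbrev Euc (d : ℕ) : Type := EuclideanSpace ℝ (Fin d)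

/-- `ANN m n` is the set of artificial neural networks
`((W_1, B_1), …, (W_L, B_L)) ∈ ×_{k=1}^L (ℝ^{l_k × l_{k-1}} × ℝ^{l_k})`, over all `L ≥ 1` and all
layer dimensions `l_0, …, l_L ≥ 1` with input dimension `l_0 = m` and output dimension `l_L = n`.
A network is built from its last layer `(W_L, B_L)` (`output`) by putting further layers in front
of it (`hidden`). All layer dimensions are positive, since every network has a positive input
dimension. -/
inductive ANN : ℕ → ℕ → Type
  | output {m n : ℕ} (hm : 0 < m) (hn : 0 < n)
      (W : Matrix (Fin n) (Fin m) ℝ) (B : Fin n → ℝ) : ANN m n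
  | hidden {m k n : ℕ} (hm : 0 < m)
      (W : Matrix (Fin k) (Fin m) ℝ) (B : Fin k → ℝ) (Φ : ANN k n) : ANN m n

/-- The number of parameters `∑_{k=1}^L l_k (l_{k-1} + 1)`. -/
def ANN.params : {m n : ℕ} → ANN m n → ℕ
  | m, n, .output _ _ _ _ => n * (m + 1)
  | m, _, .hidden (k := k) _ _ _ Φ => k * (m + 1) + Φ.params

/-- The number of hidden layers `L - 1`. -/
def ANN.hiddenLayers : {m n : ℕ} → ANN m n → ℕ
  | _, _, .output _ _ _ _ => 0
  | _, _, .hidden _ _ _ Φ => Φ.hiddenLayers + 1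

/-- The affine map `x ↦ W x + B`. -/
def affineLayer {m n : ℕ} (W : Matrix (Fin n) (Fin m) ℝ) (B : Fin n → ℝ) (x : Euc m) : Euc n :=
  WithLp.toLp 2 (W.mulVec x.ofLp + B)

/-- Componentwise application of `a`. -/
def componentwise (a : ℝ → ℝ) {n : ℕ} (x : Euc n) : Euc n :=
  WithLp.toLp 2 (fun i => a (x i))

/-- The realization of a network with activation function `a`: the activation is applied after
every layer except for the last one. -/
def ANN.realize (a : ℝ → ℝ) : {m n : ℕ} → ANN m n → Euc m → Euc n
  | _, _, .output _ _ W B => affineLayer W B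
  | _, _, .hidden _ W B Φ => fun x => Φ.realize a (componentwise a (affineLayer W B x))

/-- The rectifier function. -/
def relu (x : ℝ) : ℝ := max x 0

/-- The point `(t, x) ∈ ℝ^{d+1}` for `t ∈ ℝ`, `x ∈ ℝ^d`. -/
def timeSpace {d : ℕ} (t : ℝ) (x : Euc d) : Euc (d + 1) :=
  WithLp.toLp 2 (Fin.cons t x.ofLp)

/-- The grid point `t_n = n T / N`. -/
def gridTime (T : ℝ) (N n : ℕ) : ℝ := n * T / N

/-- `Y` is the linearly interpolated perturbed Euler approximation on `[0, T]` with `N` steps and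
drift `μ`: `Y t x y` is its value at time `t`, for the initial value `x` and the perturbations
`y = (y_1, …, y_N)`, where `y n` with `n : Fin N` stands for `y_{n+1}`. -/
def IsPerturbedEuler {d : ℕ} (T : ℝ) (N : ℕ) (μ : Euc d → Euc d)
    (Y : ℝ → Euc d → (Fin N → Euc d) → Euc d) : Prop :=
  (∀ x y, Y 0 x y = x) ∧
  ∀ n : Fin N, ∀ t ∈ Set.Icc (gridTime T N (n : ℕ)) (gridTime T N ((n : ℕ) + 1)), ∀ x y,
    Y t x y = Y (gridTime T N (n : ℕ)) x y +
      (t * N / T - ((n : ℕ) : ℝ)) • ((T / N) • μ (Y (gridTime T N n) x y) + y n)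

/-- The bound `g_n(x,y) = (‖x‖ + C t_n + max_{0 ≤ m ≤ n} ‖∑_{k=1}^m y_k‖) exp(C t_n)`;
the indices `k : Fin N` with `k < m` stand for `y_1, …, y_m`. -/
def eulerGrowthBound {d : ℕ} (C T : ℝ) (N n : ℕ) (x : Euc d) (y : Fin N → Euc d) : ℝ :=
  (‖x‖ + C * gridTime T N n +
    (Finset.range (n + 1)).sup' Finset.nonempty_range_add_one
      (fun m => ‖∑ k ∈ Finset.univ.filter (fun k : Fin N => (k : ℕ) < m), y k‖)) *
    Real.exp (C * gridTime T N n)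

/-- The perturbed Euler approximation exists. -/
theorem IsPerturbedEuler.exists {d : ℕ} {T : ℝ} (hT : 0 < T) {N : ℕ} (hN : 0 < N)
    (μ : Euc d → Euc d) : ∃ Y : ℝ → Euc d → (Fin N → Euc d) → Euc d, IsPerturbedEuler T N μ Y := by
  have hN' : (0 : ℝ) < N := by exact_mod_cast hN
  let inc : ℕ → Euc d → (Fin N → Euc d) → Euc d := fun n z y =>
    (T / N) • μ z + (if h : n < N then y ⟨n, h⟩ else 0)
  let G : ℕ → Euc d → (Fin N → Euc d) → Euc d := fun n x y =>
    Nat.rec x (fun n z => z + inc n z y) n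
  let Y : ℝ → Euc d → (Fin N → Euc d) → Euc d := fun t x y =>
    G ⌊t * N / T⌋₊ x y + (t * N / T - ⌊t * N / T⌋₊) • inc ⌊t * N / T⌋₊ (G ⌊t * N / T⌋₊ x y) y
  have hg : ∀ n : ℕ, gridTime T N n * N / T = n := by
    intro n; unfold gridTime; field_simp
  have hY : ∀ (n : ℕ) x y, Y (gridTime T N n) x y = G n x y := by
    intro n x y
    simp only [Y, hg, Nat.floor_natCast, sub_self, zero_smul, add_zero]
  refine ⟨Y, fun x y => ?_, fun n t ht x y => ?_⟩
  · have := hY 0 x y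
    simpa [gridTime, G] using this
  · rw [hY]
    have h1 : (n : ℝ) ≤ t * N / T := by
      have := ht.1
      rw [← hg n]; gcongr
    have h2 : t * N / T ≤ ((n + 1 : ℕ) : ℝ) := by
      have := ht.2
      rw [← hg (n + 1)]; gcongr
    have hinc : ∀ z, inc n z y = (T / N) • μ z + y n := by
      intro z; simp [inc]
    rcases h2.lt_or_eq with h3 | h3
    · have hf : ⌊t * N / T⌋₊ = (n : ℕ) := by
        rw [Nat.floor_eq_iff (le_trans (Nat.cast_nonneg _) h1)]
        exact ⟨h1, by push_cast at h3; exact h3⟩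
      simp only [Y, hf, hinc]
    · have : t = gridTime T N (n + 1) := by
        rw [← hg (n + 1)] at h3
        field_simp at h3
        exact h3
      rw [this, hY, hg]
      have : G (n + 1) x y = G n x y + inc n (G n x y) y := rfl
      rw [this, hinc]
      simp

/-- The perturbed Euler approximation is unique on `[0, T]`. -/
theorem IsPerturbedEuler.unique {d : ℕ} {T : ℝ} (hT : 0 < T) {N : ℕ} (hN : 0 < N)
    {μ : Euc d → Euc d} {Y Z : ℝ → Euc d → (Fin N → Euc d) → Euc d}
    (hY : IsPerturbedEuler T N μ Y) (hZ : IsPerturbedEuler T N μ Z) :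
    ∀ t ∈ Set.Icc 0 T, ∀ x y, Y t x y = Z t x y := by
  have hN' : (0 : ℝ) < N := by exact_mod_cast hN
  have key : ∀ n : ℕ, n ≤ N → ∀ x y, Y (gridTime T N n) x y = Z (gridTime T N n) x y := by
    intro n
    induction n with
    | zero => intro _ x y; simp [gridTime, hY.1, hZ.1]
    | succ n ih =>
      intro hn x y
      have hmem : gridTime T N (n + 1) ∈ Set.Icc (gridTime T N n) (gridTime T N (n + 1)) := by
        refine ⟨?_, le_rfl⟩
        unfold gridTime; gcongr; linarith
      rw [hY.2 ⟨n, hn⟩ _ hmem, hZ.2 ⟨n, hn⟩ _ hmem]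
      simp only [ih (by omega)]
  intro t ht x y
  have h0 : 0 ≤ t * N / T := by have := ht.1; positivity
  have hle : t * N / T ≤ N := by
    rw [div_le_iff₀ hT]; nlinarith [ht.2]
  obtain ⟨n, hn, h1, h2⟩ : ∃ n : ℕ, n < N ∧ (n : ℝ) ≤ t * N / T ∧ t * N / T ≤ n + 1 := by
    rcases hle.lt_or_eq with h | h
    · exact ⟨⌊t * N / T⌋₊, (Nat.floor_lt h0).2 h, Nat.floor_le h0, (Nat.lt_floor_add_one _).le⟩
    · refine ⟨N - 1, by omega, ?_, ?_⟩ <;> rw [h, Nat.cast_pred hN] <;> linarith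
  have hmem : t ∈ Set.Icc (gridTime T N n) (gridTime T N (n + 1)) := by
    rw [le_div_iff₀ hT] at h1
    rw [div_le_iff₀ hT] at h2
    unfold gridTime
    push_cast
    exact ⟨(div_le_iff₀ hN').2 h1, (le_div_iff₀ hN').2 h2⟩
  rw [hY.2 ⟨n, hn⟩ t hmem, hZ.2 ⟨n, hn⟩ t hmem]
  simp only [key n hn.le]

end

noncomputable section

/-- `IsReluNet w L f` says that `f` is computed by `L` hidden rectifier layers of widths between
`1` and `w`, with affine maps before, between and after them. -/
def IsReluNet (w : ℕ) : ℕ → ∀ {V W : Type} [AddCommGroup V] [Module ℝ V] [AddCommGroup W]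
    [Module ℝ W], (V → W) → Prop
  | 0, V, W, _, _, _, _, f => ∃ A : V →ᵃ[ℝ] W, ∀ x, f x = A x
  | L + 1, V, W, _, _, _, _, f => ∃ (ι : Type) (_ : Fintype ι) (_ : Nonempty ι)
      (A : V →ᵃ[ℝ] (ι → ℝ)) (g : (ι → ℝ) → W),
      Fintype.card ι ≤ w ∧ IsReluNet w L g ∧ ∀ x, f x = g (fun i => relu (A x i))

namespace IsReluNet

variable {U V W W' : Type} [AddCommGroup U] [Module ℝ U] [AddCommGroup V] [Module ℝ V]
  [AddCommGroup W] [Module ℝ W] [AddCommGroup W'] [Module ℝ W']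

theorem of_affine (w : ℕ) (A : V →ᵃ[ℝ] W) : IsReluNet w 0 (fun x => A x) := ⟨A, fun _ => rfl⟩

theorem mono {w w' : ℕ} (h : w ≤ w') {L : ℕ} {f : V → W} (hf : IsReluNet w L f) :
    IsReluNet w' L f := by
  induction L generalizing V with
  | zero => exact hf
  | succ L ih =>
    obtain ⟨ι, i1, i2, A, g, hc, hg, he⟩ := hf
    exact ⟨ι, i1, i2, A, g, hc.trans h, ih hg, he⟩

theorem comp_affine {w L : ℕ} {f : V → W} (hf : IsReluNet w L f) (A : U →ᵃ[ℝ] V) :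
    IsReluNet w L (fun x => f (A x)) := by
  cases L with
  | zero =>
    obtain ⟨B, hB⟩ := hf
    exact ⟨B.comp A, fun x => hB _⟩
  | succ L =>
    obtain ⟨ι, i1, i2, B, g, hc, hg, he⟩ := hf
    exact ⟨ι, i1, i2, B.comp A, g, hc, hg, fun x => he _⟩

theorem comp_linear {w L : ℕ} {f : V → W} (hf : IsReluNet w L f) (A : U →ₗ[ℝ] V) :
    IsReluNet w L (fun x => f (A x)) := hf.comp_affine A.toAffineMap

theorem comp {w L₁ L₂ : ℕ} {f : U → V} {g : V → W} (hg : IsReluNet w L₂ g)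
    (hf : IsReluNet w L₁ f) : IsReluNet w (L₁ + L₂) (fun x => g (f x)) := by
  induction L₁ generalizing U with
  | zero =>
    obtain ⟨A, hA⟩ := hf
    simp only [hA, Nat.zero_add]
    exact hg.comp_affine A
  | succ L ih =>
    obtain ⟨ι, i1, i2, A, f', hc, hf', he⟩ := hf
    rw [show L + 1 + L₂ = (L + L₂) + 1 by omega]
    exact ⟨ι, i1, i2, A, fun v => g (f' v), hc, ih hf', fun x => by simp only [he]⟩

theorem affine_comp {w L : ℕ} {f : V → W} (hf : IsReluNet w L f) (B : W →ᵃ[ℝ] W') :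
    IsReluNet w L (fun x => B (f x)) := (of_affine w B).comp hf

theorem linear_comp {w L : ℕ} {f : V → W} (hf : IsReluNet w L f) (B : W →ₗ[ℝ] W') :
    IsReluNet w L (fun x => B (f x)) := hf.affine_comp B.toAffineMap

theorem pi {ι : Type} [Fintype ι] [Nonempty ι] {w L : ℕ} {f : ι → V → W}
    (hf : ∀ i, IsReluNet w L (f i)) : IsReluNet (Fintype.card ι * w) L (fun x i => f i x) := by
  induction L generalizing V with
  | zero =>
    choose A hA using hf
    exact ⟨AffineMap.pi A, fun x => by ext i; simp [hA]⟩
  | succ L ih =>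
    choose κ i1 i2 A g hc hg he using hf
    have : Nonempty (Σ i, κ i) := ⟨⟨Classical.arbitrary ι, Classical.choice (i2 _)⟩⟩
    refine ⟨Σ i, κ i, inferInstance, this, AffineMap.pi (fun p =>
      (AffineMap.proj p.2).comp (A p.1)), fun v i => g i (fun j => v ⟨i, j⟩), ?_, ?_, ?_⟩
    · rw [Fintype.card_sigma]
      exact (Finset.sum_le_card_nsmul _ _ _ (fun i _ => hc i)).trans (by simp)
    · exact ih (fun i => (hg i).comp_linear (LinearMap.funLeft ℝ ℝ (fun j => (⟨i, j⟩ : Σ i, κ i))))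
    · intro x
      ext i
      simp [he]

theorem prodMk {w₁ w₂ L : ℕ} {f : V → W} {g : V → W'} (hf : IsReluNet w₁ L f)
    (hg : IsReluNet w₂ L g) : IsReluNet (w₁ + w₂) L (fun x => (f x, g x)) := by
  induction L generalizing V with
  | zero =>
    obtain ⟨A, hA⟩ := hf
    obtain ⟨B, hB⟩ := hg
    exact ⟨A.prod B, fun x => by simp [hA, hB]⟩
  | succ L ih =>
    obtain ⟨ι, i1, i2, A, f', hc, hf', he⟩ := hf
    obtain ⟨κ, j1, j2, B, g', hc', hg', he'⟩ := hg
    refine ⟨ι ⊕ κ, inferInstance, inferInstance, AffineMap.pi (Sum.elim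
      (fun i => (AffineMap.proj i).comp A) (fun i => (AffineMap.proj i).comp B)),
      fun v => (f' (fun i => v (.inl i)), g' (fun i => v (.inr i))), ?_, ?_, ?_⟩
    · rw [Fintype.card_sum]; omega
    · exact ih (hf'.comp_linear (LinearMap.funLeft ℝ ℝ Sum.inl))
        (hg'.comp_linear (LinearMap.funLeft ℝ ℝ Sum.inr))
    · intro x
      simp [he, he']

theorem add {w₁ w₂ L : ℕ} {f g : V → W} (hf : IsReluNet w₁ L f) (hg : IsReluNet w₂ L g) :
    IsReluNet (w₁ + w₂) L (fun x => f x + g x) :=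
  (hf.prodMk hg).linear_comp (LinearMap.fst ℝ W W + LinearMap.snd ℝ W W)

theorem const_smul {w L : ℕ} {f : V → W} (hf : IsReluNet w L f) (c : ℝ) :
    IsReluNet w L (fun x => c • f x) := hf.linear_comp (c • LinearMap.id)

theorem const_mul {w L : ℕ} {f : V → ℝ} (hf : IsReluNet w L f) (c : ℝ) :
    IsReluNet w L (fun x => c * f x) := hf.const_smul c

theorem add_const {w L : ℕ} {f : V → W} (hf : IsReluNet w L f) (c : W) :
    IsReluNet w L (fun x => f x + c) :=
  hf.affine_comp (AffineMap.id ℝ W + AffineMap.const ℝ W c)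

theorem relu_affine (l : V →ₗ[ℝ] ℝ) (c : ℝ) : IsReluNet 1 1 (fun x => relu (l x + c)) :=
  ⟨Unit, inferInstance, inferInstance,
    AffineMap.pi (fun _ => l.toAffineMap + AffineMap.const ℝ V c),
    fun v => v (), by simp, ⟨(LinearMap.proj ()).toAffineMap, fun _ => rfl⟩, fun x => by simp⟩

theorem relu_sub_relu_neg (x : ℝ) : relu x - relu (-x) = x := by
  unfold relu
  rcases le_total x 0 with h | h
  · rw [max_eq_right h, max_eq_left (by linarith)]; ring
  · rw [max_eq_left h, max_eq_right (by linarith)]; ring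

theorem id_real (L : ℕ) : IsReluNet 2 L (fun x : ℝ => x) := by
  induction L with
  | zero => exact of_affine 2 (AffineMap.id ℝ ℝ)
  | succ L ih =>
    have h : IsReluNet 2 1 (fun x : ℝ => x) := by
      convert (relu_affine (LinearMap.id (R := ℝ) (M := ℝ)) 0).add
        ((relu_affine (-LinearMap.id (R := ℝ) (M := ℝ)) 0).const_mul (-1)) using 2 with x
      simp only [LinearMap.id_apply, add_zero, LinearMap.neg_apply]
      linarith [relu_sub_relu_neg x]
    exact h.comp ih

theorem linear_real (l : V →ₗ[ℝ] ℝ) (L : ℕ) : IsReluNet 2 L (fun x => l x) :=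
  (id_real L).comp_linear l

/-- The `i`-th coordinate on `Euc d`. -/
def coord {d : ℕ} (i : Fin d) : Euc d →ₗ[ℝ] ℝ :=
  (LinearMap.proj i).comp (WithLp.linearEquiv 2 ℝ (Fin d → ℝ)).toLinearMap

@[simp] theorem coord_apply {d : ℕ} (i : Fin d) (x : Euc d) : coord i x = x i := rfl

theorem euc {d : ℕ} (hd : 0 < d) {w L : ℕ} {f : V → Euc d}
    (hf : ∀ i, IsReluNet w L (fun x => f x i)) : IsReluNet (d * w) L f := by
  have : Nonempty (Fin d) := ⟨⟨0, hd⟩⟩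
  have h := (pi hf).linear_comp (WithLp.linearEquiv 2 ℝ (Fin d → ℝ)).symm.toLinearMap
  rwa [Fintype.card_fin] at h

theorem linear_euc {d : ℕ} (hd : 0 < d) (l : V →ₗ[ℝ] Euc d) (L : ℕ) :
    IsReluNet (d * 2) L (fun x => l x) :=
  euc hd (fun i => linear_real ((coord i).comp l) L)

end IsReluNet

theorem exists_affineLayer {m n : ℕ} (A : Euc m →ᵃ[ℝ] Euc n) :
    ∃ (W : Matrix (Fin n) (Fin m) ℝ) (B : Fin n → ℝ), ∀ x, A x = affineLayer W B x := by
  refine ⟨LinearMap.toMatrix' ((WithLp.linearEquiv 2 ℝ (Fin n → ℝ)).toLinearMap ∘ₗ A.linear ∘ₗ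
    (WithLp.linearEquiv 2 ℝ (Fin m → ℝ)).symm.toLinearMap), (A 0).ofLp, fun x => ?_⟩
  have h : A x = A.linear x + A 0 := congrFun A.decomp x
  rw [h]
  ext i
  simp [affineLayer, LinearMap.toMatrix'_mulVec]

/-- The affine map of a layer. -/
def affineLayerMap {m n : ℕ} (W : Matrix (Fin n) (Fin m) ℝ) (B : Fin n → ℝ) :
    Euc m →ᵃ[ℝ] Euc n :=
  ((WithLp.linearEquiv 2 ℝ (Fin n → ℝ)).symm.toLinearMap ∘ₗ Matrix.mulVecLin W ∘ₗ
    (WithLp.linearEquiv 2 ℝ (Fin m → ℝ)).toLinearMap).toAffineMap +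
    AffineMap.const ℝ (Euc m) (WithLp.toLp 2 B)

theorem affineLayerMap_apply {m n : ℕ} (W : Matrix (Fin n) (Fin m) ℝ) (B : Fin n → ℝ)
    (x : Euc m) : affineLayerMap W B x = affineLayer W B x := by
  ext i
  simp [affineLayerMap, affineLayer]

theorem ANN.input_pos {m n : ℕ} (Φ : ANN m n) : 0 < m := by
  cases Φ <;> assumption

theorem ANN.params_ge_output {m n : ℕ} (Φ : ANN m n) : n ≤ Φ.params := by
  induction Φ with
  | output => simp only [ANN.params]; nlinarith
  | hidden => simp only [ANN.params]; omega

theorem ANN.isReluNet {m n : ℕ} (Φ : ANN m n) :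
    IsReluNet Φ.params Φ.hiddenLayers (Φ.realize relu) := by
  induction Φ with
  | output hm hn W B => exact ⟨affineLayerMap W B, fun x => (affineLayerMap_apply W B x).symm⟩
  | @hidden m k n hm W B Φ ih =>
    have : Nonempty (Fin k) := ⟨⟨0, Φ.input_pos⟩⟩
    refine ⟨Fin k, inferInstance, this, (WithLp.linearEquiv 2 ℝ (Fin k → ℝ)).toAffineMap.comp
      (affineLayerMap W B), fun v => Φ.realize relu (WithLp.toLp 2 v), ?_, ?_, ?_⟩
    · simp only [Fintype.card_fin, ANN.params]; nlinarith
    · refine (ih.mono ?_).comp_linear (WithLp.linearEquiv 2 ℝ (Fin k → ℝ)).symm.toLinearMap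
      simp [ANN.params]
    · intro x
      simp [ANN.realize, componentwise, affineLayerMap_apply]

theorem ANN.continuous_realize {m n : ℕ} (Φ : ANN m n) : Continuous (Φ.realize relu) := by
  have haff : ∀ {m n : ℕ} (W : Matrix (Fin n) (Fin m) ℝ) (B : Fin n → ℝ),
      Continuous (affineLayer W B) := fun W B => by
    unfold affineLayer; fun_prop
  induction Φ with
  | output hm hn W B => exact haff W B
  | hidden hm W B Φ ih =>
    have h := haff W B
    have h' : Continuous fun x => componentwise relu (affineLayer W B x) := by
      unfold componentwise relu
      fun_prop
    exact ih.comp h'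

theorem IsReluNet.exists_ann {w L m n : ℕ} (hm : 0 < m) (hn : 0 < n) (hmw : m ≤ w) (hnw : n ≤ w)
    {f : Euc m → Euc n} (hf : IsReluNet w L f) :
    ∃ Ψ : ANN m n, Ψ.realize relu = f ∧ Ψ.params ≤ (L + 1) * (w * (w + 1)) := by
  induction L generalizing m with
  | zero =>
    obtain ⟨A, hA⟩ := hf
    obtain ⟨W, B, hWB⟩ := exists_affineLayer A
    refine ⟨.output hm hn W B, ?_, ?_⟩
    · ext1 x; rw [hA, hWB]; rfl
    · simp only [ANN.params, zero_add, one_mul]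
      gcongr
  | succ L ih =>
    obtain ⟨ι, i1, i2, A, g, hc, hg, he⟩ := hf
    let e := Fintype.equivFin ι
    obtain ⟨Ψ, h1, h2⟩ := ih (Fintype.card_pos (α := ι)) hc
      (f := fun v => g (fun i => v (e i)))
      (hg.comp_linear ((LinearMap.funLeft ℝ ℝ e).comp
        (WithLp.linearEquiv 2 ℝ (Fin (Fintype.card ι) → ℝ)).toLinearMap))
    obtain ⟨W, B, hWB⟩ := exists_affineLayer
      (((WithLp.linearEquiv 2 ℝ (Fin (Fintype.card ι) → ℝ)).symm.toLinearMap.comp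
        (LinearMap.funLeft ℝ ℝ e.symm)).toAffineMap.comp A)
    refine ⟨.hidden hm W B Ψ, ?_, ?_⟩
    · ext1 x
      simp only [ANN.realize, h1, he, ← hWB]
      simp [componentwise, LinearMap.funLeft]
    · have : Fintype.card ι * (m + 1) ≤ w * (w + 1) := by gcongr
      simp only [ANN.params]
      calc _ ≤ w * (w + 1) + (L + 1) * (w * (w + 1)) := by gcongr
        _ = _ := by ring

/-- The tent map on `[0, 1]`, extended affinely. -/
def tent (x : ℝ) : ℝ := 2 * relu x - 4 * relu (x - 1 / 2)

theorem tent_of_le {x : ℝ} (h0 : 0 ≤ x) (h : x ≤ 1 / 2) : tent x = 2 * x := by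
  unfold tent relu
  rw [max_eq_left h0, max_eq_right (by linarith)]; ring

theorem tent_of_ge {x : ℝ} (h : 1 / 2 ≤ x) : tent x = 2 - 2 * x := by
  unfold tent relu
  rw [max_eq_left (by linarith), max_eq_left (by linarith)]; ring

theorem continuous_tent : Continuous tent := by
  unfold tent relu; fun_prop

/-- The piecewise linear interpolation of `x ↦ x ^ 2` with `2 ^ m` equal pieces of `[0, 1]`. -/
def sqApprox : ℕ → ℝ → ℝ
  | 0, x => x
  | m + 1, x => x - tent x / 2 + sqApprox m (tent x) / 4

theorem continuous_sqApprox (m : ℕ) : Continuous (sqApprox m) := by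
  induction m with
  | zero => exact continuous_id
  | succ m ih =>
    have := ih.comp continuous_tent
    have h := continuous_tent
    simp only [sqApprox]
    fun_prop

theorem sqApprox_sub_sq_mem (m : ℕ) {x : ℝ} (h0 : 0 ≤ x) (h1 : x ≤ 1) :
    sqApprox m x - x ^ 2 ∈ Set.Icc 0 ((1 / 4 : ℝ) ^ (m + 1)) := by
  induction m generalizing x with
  | zero =>
    simp only [sqApprox]
    constructor <;> nlinarith [sq_nonneg (x - 1 / 2)]
  | succ m ih =>
    have key : 0 ≤ tent x ∧ tent x ≤ 1 ∧ x ^ 2 = x - tent x / 2 + tent x ^ 2 / 4 := by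
      rcases le_total x (1 / 2) with h | h
      · rw [tent_of_le h0 h]
        exact ⟨by linarith, by linarith, by ring⟩
      · rw [tent_of_ge h]
        exact ⟨by linarith, by linarith, by ring⟩
    obtain ⟨k0, k1, k2⟩ := key
    obtain ⟨i0, i1⟩ := ih k0 k1
    rw [k2, pow_succ]
    simp only [sqApprox]
    constructor <;> linarith

/-- An approximation of the product on `[-1, 1] × [-1, 1]`. -/
def mulApprox (m : ℕ) (h u : ℝ) : ℝ := sqApprox m |(h + u) / 2| - sqApprox m |(h - u) / 2|

theorem mulApprox_zero_left (m : ℕ) (u : ℝ) : mulApprox m 0 u = 0 := by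
  simp only [mulApprox, zero_add, zero_sub, neg_div, abs_neg, sub_self]

theorem abs_mulApprox_sub_le (m : ℕ) {h u : ℝ} (hh : |h| ≤ 1) (hu : |u| ≤ 1) :
    |mulApprox m h u - h * u| ≤ (1 / 4 : ℝ) ^ (m + 1) := by
  rw [abs_le] at hh hu
  obtain ⟨a0, a1⟩ := sqApprox_sub_sq_mem m (abs_nonneg ((h + u) / 2))
    (abs_le.2 ⟨by linarith, by linarith⟩)
  obtain ⟨b0, b1⟩ := sqApprox_sub_sq_mem m (abs_nonneg ((h - u) / 2))
    (abs_le.2 ⟨by linarith, by linarith⟩)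
  rw [sq_abs] at a0 a1 b0 b1
  rw [mulApprox, abs_le]
  constructor <;> linarith

/-- The truncation of a real number to `[-1, 1]`. -/
def clip (x : ℝ) : ℝ := relu (x + 1) - relu (x - 1) - 1

theorem abs_clip_le (x : ℝ) : |clip x| ≤ 1 := by
  unfold clip relu
  rw [abs_le]
  constructor <;> rcases max_cases (x + 1) 0 with h | h <;>
    rcases max_cases (x - 1) 0 with h' | h' <;> linarith

theorem clip_of_abs_le {x : ℝ} (h : |x| ≤ 1) : clip x = x := by
  rw [abs_le] at h
  unfold clip relu
  rw [max_eq_left (by linarith), max_eq_right (by linarith)]; ring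

theorem abs_clip_le_abs (x : ℝ) : |clip x| ≤ |x| := by
  rcases le_total |x| 1 with h | h
  · rw [clip_of_abs_le h]
  · exact (abs_clip_le x).trans h

theorem abs_clip_sub_le_abs (x : ℝ) : |clip x - x| ≤ |x| := by
  rcases le_total |x| 1 with h | h
  · rw [clip_of_abs_le h, sub_self, abs_zero]; exact abs_nonneg x
  · unfold clip relu
    rcases le_total 0 x with h' | h'
    · rw [abs_of_nonneg h'] at h
      rw [max_eq_left (by linarith), max_eq_left (by linarith), abs_le]
      constructor <;> linarith [le_abs_self x]
    · rw [abs_of_nonpos h'] at h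
      rw [max_eq_right (by linarith), max_eq_right (by linarith), abs_le]
      constructor <;> linarith [neg_le_abs x]

/-- The hat function with peak `1` at `k` and support `[k - 1, k + 1]`. -/
def hat (k : ℕ) (s : ℝ) : ℝ := relu (s - k + 1) - 2 * relu (s - k) + relu (s - k - 1)

theorem hat_of_le {k : ℕ} {s : ℝ} (h : s ≤ k - 1) : hat k s = 0 := by
  unfold hat relu
  rw [max_eq_right (by linarith), max_eq_right (by linarith), max_eq_right (by linarith)]; ring

theorem hat_of_ge {k : ℕ} {s : ℝ} (h : k + 1 ≤ s) : hat k s = 0 := by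
  unfold hat relu
  rw [max_eq_left (by linarith), max_eq_left (by linarith), max_eq_left (by linarith)]; ring

theorem hat_of_mem_left {k : ℕ} {s : ℝ} (h : k - 1 ≤ s) (h' : s ≤ k) : hat k s = s - k + 1 := by
  unfold hat relu
  rw [max_eq_left (by linarith), max_eq_right (by linarith), max_eq_right (by linarith)]; ring

theorem hat_of_mem_right {k : ℕ} {s : ℝ} (h : k ≤ s) (h' : s ≤ k + 1) : hat k s = k + 1 - s := by
  unfold hat relu
  rw [max_eq_left (by linarith), max_eq_left (by linarith), max_eq_right (by linarith)]; ring

/-- An approximation of `h • z` for `|h| ≤ 1`. -/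
def smulApprox {d : ℕ} (ε : ℝ) (m : ℕ) (h : ℝ) (z : Euc d) : Euc d :=
  WithLp.toLp 2 (fun i => ε⁻¹ * mulApprox m h (clip (ε * z i)))

theorem smulApprox_zero_left {d : ℕ} (ε : ℝ) (m : ℕ) (z : Euc d) : smulApprox ε m 0 z = 0 := by
  ext i
  simp [smulApprox, mulApprox_zero_left]

theorem continuous_smulApprox {d : ℕ} (ε : ℝ) (m : ℕ) (h : ℝ) :
    Continuous (smulApprox (d := d) ε m h) := by
  have h1 := continuous_sqApprox m
  unfold smulApprox mulApprox clip relu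
  fun_prop

theorem Euc.norm_le_of_abs_le {d : ℕ} {v : Euc d} {c : ℝ} (hc : 0 ≤ c) (h : ∀ i, |v i| ≤ c) :
    ‖v‖ ≤ √d * c := by
  rw [EuclideanSpace.norm_eq]
  refine Real.sqrt_le_iff.2 ⟨by positivity, ?_⟩
  rw [mul_pow, Real.sq_sqrt (by positivity)]
  refine (Finset.sum_le_card_nsmul _ _ (c ^ 2) fun i _ => ?_).trans (by simp)
  have := h i
  rw [Real.norm_eq_abs]
  gcongr

theorem Euc.norm_le_norm {d : ℕ} {v w : Euc d} (h : ∀ i, |v i| ≤ |w i|) : ‖v‖ ≤ ‖w‖ := by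
  rw [EuclideanSpace.norm_eq, EuclideanSpace.norm_eq]
  refine Real.sqrt_le_sqrt (Finset.sum_le_sum fun i _ => ?_)
  have := h i
  rw [Real.norm_eq_abs, Real.norm_eq_abs]
  gcongr

/-- Coordinatewise truncation of `z` to `[-ε⁻¹, ε⁻¹]`. -/
def clipVec {d : ℕ} (ε : ℝ) (z : Euc d) : Euc d := WithLp.toLp 2 (fun i => ε⁻¹ * clip (ε * z i))

section

variable {d : ℕ} {ε : ℝ} (hε : 0 < ε)
include hε

theorem norm_clipVec_le (z : Euc d) : ‖clipVec ε z‖ ≤ ‖z‖ := by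
  refine Euc.norm_le_norm fun i => ?_
  have h := abs_clip_le_abs (ε * z i)
  rw [abs_mul, abs_of_pos hε] at h
  simp only [clipVec, abs_mul, abs_inv, abs_of_pos hε]
  rwa [inv_mul_le_iff₀ hε]

theorem norm_clipVec_sub_le (z : Euc d) : ‖clipVec ε z - z‖ ≤ ‖z‖ := by
  refine Euc.norm_le_norm fun i => ?_
  have h := abs_clip_sub_le_abs (ε * z i)
  have e : (clipVec ε z - z) i = ε⁻¹ * (clip (ε * z i) - ε * z i) := by
    simp only [clipVec, PiLp.sub_apply]
    field_simp
  rw [abs_mul ε, abs_of_pos hε] at h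
  rw [e, abs_mul, abs_inv, abs_of_pos hε]
  rwa [inv_mul_le_iff₀ hε]

theorem clipVec_of_norm_le {z : Euc d} (h : ‖z‖ ≤ ε⁻¹) : clipVec ε z = z := by
  ext i
  have h1 : |z i| ≤ ε⁻¹ := (PiLp.norm_apply_le z i).trans h
  have h2 : |ε * z i| ≤ 1 := by
    rw [abs_mul, abs_of_pos hε]
    calc ε * |z i| ≤ ε * ε⁻¹ := by gcongr
      _ = 1 := mul_inv_cancel₀ hε.ne'
  simp only [clipVec, clip_of_abs_le h2]
  field_simp

theorem norm_smulApprox_sub_clipVec_le {m : ℕ} (hm : (1 / 4 : ℝ) ^ (m + 1) ≤ ε ^ 2) {h : ℝ}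
    (hh : |h| ≤ 1) (z : Euc d) : ‖smulApprox ε m h z - h • clipVec ε z‖ ≤ √d * ε := by
  refine Euc.norm_le_of_abs_le hε.le fun i => ?_
  have e : (smulApprox ε m h z - h • clipVec ε z) i =
      ε⁻¹ * (mulApprox m h (clip (ε * z i)) - h * clip (ε * z i)) := by
    simp only [smulApprox, clipVec, PiLp.sub_apply, PiLp.smul_apply, smul_eq_mul]
    ring
  rw [e, abs_mul, abs_inv, abs_of_pos hε, inv_mul_le_iff₀ hε, ← sq]
  exact (abs_mulApprox_sub_le m hh (abs_clip_le _)).trans hm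

theorem norm_smulApprox_le {m : ℕ} (hm : (1 / 4 : ℝ) ^ (m + 1) ≤ ε ^ 2) {h : ℝ}
    (hh : |h| ≤ 1) (z : Euc d) : ‖smulApprox ε m h z‖ ≤ √d * ε + ‖z‖ := by
  have h1 := norm_smulApprox_sub_clipVec_le hε hm hh z
  have h2 : ‖h • clipVec ε z‖ ≤ ‖z‖ := by
    rw [norm_smul, Real.norm_eq_abs]
    calc |h| * ‖clipVec ε z‖ ≤ 1 * ‖z‖ := by gcongr; exact norm_clipVec_le hε z
      _ = ‖z‖ := one_mul _
  calc ‖smulApprox ε m h z‖ = ‖(smulApprox ε m h z - h • clipVec ε z) + h • clipVec ε z‖ := by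
        rw [sub_add_cancel]
    _ ≤ _ := (norm_add_le _ _).trans (by gcongr)

theorem norm_smulApprox_sub_smul_le (hε1 : ε ≤ 1) {q : ℝ} (hq : 2 ≤ q) {m : ℕ}
    (hm : (1 / 4 : ℝ) ^ (m + 1) ≤ ε ^ 2) {h : ℝ} (hh : |h| ≤ 1) (z : Euc d) :
    ‖smulApprox ε m h z - h • z‖ ≤ √d * ε + ε * ‖z‖ ^ q := by
  have h1 := norm_smulApprox_sub_clipVec_le hε hm hh z
  have h2 : ‖h • (clipVec ε z - z)‖ ≤ ε * ‖z‖ ^ q := by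
    rcases le_total ‖z‖ ε⁻¹ with hz | hz
    · rw [clipVec_of_norm_le hε hz, sub_self, smul_zero, norm_zero]
      positivity
    · have hz1 : 1 ≤ ‖z‖ := (one_le_inv₀ hε |>.2 hε1).trans hz
      have hz2 : 1 ≤ ε * ‖z‖ := by rwa [inv_le_iff_one_le_mul₀' hε] at hz
      rw [norm_smul, Real.norm_eq_abs]
      calc |h| * ‖clipVec ε z - z‖ ≤ 1 * ‖z‖ := by gcongr; exact norm_clipVec_sub_le hε z
        _ ≤ (ε * ‖z‖) * ‖z‖ := by gcongr
        _ = ε * ‖z‖ ^ (2 : ℝ) := by rw [Real.rpow_two]; ring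
        _ ≤ ε * ‖z‖ ^ q := by gcongr
  calc ‖smulApprox ε m h z - h • z‖
      = ‖(smulApprox ε m h z - h • clipVec ε z) + h • (clipVec ε z - z)‖ := by
        congr 1; module
    _ ≤ _ := (norm_add_le _ _).trans (by gcongr)

end

/-- The values of the perturbed Euler approximation at the grid points. -/
def eulerGrid {d : ℕ} (T : ℝ) (N : ℕ) (μ : Euc d → Euc d) (x : Euc d) (y : Fin N → Euc d) :
    ℕ → Euc d
  | 0 => x
  | n + 1 => eulerGrid T N μ x y n + (T / N) • μ (eulerGrid T N μ x y n)
      + if h : n < N then y ⟨n, h⟩ else 0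

section

variable {d N : ℕ} {T : ℝ} {μ : Euc d → Euc d}

theorem continuous_eulerGrid (hμ : Continuous μ) (x : Euc d) (n : ℕ) :
    Continuous (fun y : Fin N → Euc d => eulerGrid T N μ x y n) := by
  induction n with
  | zero => exact continuous_const
  | succ n ih =>
    simp only [eulerGrid]
    refine (ih.add ((hμ.comp ih).const_smul (T / N : ℝ))).add ?_
    split_ifs with h
    · fun_prop
    · fun_prop

theorem eulerGrid_congr (x : Euc d) {y z : Fin N → Euc d} {n : ℕ}
    (h : ∀ k : Fin N, (k : ℕ) < n → y k = z k) : eulerGrid T N μ x y n = eulerGrid T N μ x z n := by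
  induction n with
  | zero => rfl
  | succ n ih =>
    simp only [eulerGrid, ih fun k hk => h k (by omega)]
    congr 1
    split_ifs with hn
    · exact h _ (by simp)
    · rfl

theorem gridTime_mul_div (hT : 0 < T) (hN : 0 < N) (n : ℕ) : gridTime T N n * N / T = n := by
  have : (0 : ℝ) < N := by exact_mod_cast hN
  unfold gridTime; field_simp

theorem gridTime_le_succ (hT : 0 < T) (n : ℕ) : gridTime T N n ≤ gridTime T N (n + 1) := by
  unfold gridTime; gcongr; linarith

theorem IsPerturbedEuler.apply_gridTime {Y : ℝ → Euc d → (Fin N → Euc d) → Euc d}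
    (hY : IsPerturbedEuler T N μ Y) (hT : 0 < T) (hN : 0 < N) (x : Euc d) (y : Fin N → Euc d)
    {n : ℕ} (hn : n ≤ N) : Y (gridTime T N n) x y = eulerGrid T N μ x y n := by
  induction n with
  | zero => simp [gridTime, hY.1, eulerGrid]
  | succ n ih =>
    have h := hY.2 ⟨n, hn⟩ (gridTime T N (n + 1)) ⟨gridTime_le_succ hT n, le_rfl⟩ x y
    have e := gridTime_mul_div hT hN (n + 1)
    simp only at h
    rw [e, ih (by omega)] at h
    rw [h, eulerGrid, dif_pos (show n < N by omega)]
    push_cast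
    module

theorem IsPerturbedEuler.apply_eq {Y : ℝ → Euc d → (Fin N → Euc d) → Euc d}
    (hY : IsPerturbedEuler T N μ Y) (hT : 0 < T) (hN : 0 < N) (x : Euc d) (y : Fin N → Euc d)
    {n : ℕ} (hn : n < N) {t : ℝ} (ht : t ∈ Set.Icc (gridTime T N n) (gridTime T N (n + 1))) :
    Y t x y = (n + 1 - t * N / T) • eulerGrid T N μ x y n +
      (t * N / T - n) • eulerGrid T N μ x y (n + 1) := by
  have h := hY.2 ⟨n, hn⟩ t ht x y
  simp only at h
  rw [h, hY.apply_gridTime hT hN x y hn.le, eulerGrid, dif_pos hn]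
  module

theorem eulerGrid_eq_sum (x : Euc d) (y : Fin N → Euc d) {n : ℕ} (hn : n ≤ N) :
    eulerGrid T N μ x y n = x + ∑ k ∈ Finset.range n, (T / N) • μ (eulerGrid T N μ x y k) +
      ∑ k ∈ Finset.univ.filter (fun k : Fin N => (k : ℕ) < n), y k := by
  induction n with
  | zero => simp [eulerGrid]
  | succ n ih =>
    have : Finset.univ.filter (fun k : Fin N => (k : ℕ) < n + 1) =
        insert ⟨n, hn⟩ (Finset.univ.filter (fun k : Fin N => (k : ℕ) < n)) := by
      ext k
      simp [Fin.ext_iff]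
      omega
    rw [this, Finset.sum_insert (by simp), Finset.sum_range_succ, eulerGrid,
      dif_pos (show n < N by omega), ih (by omega)]
    abel

theorem norm_eulerGrid_le {C : ℝ} (hC : 0 ≤ C) (hT : 0 < T)
    (hμ : ∀ x, ‖μ x‖ ≤ C * (1 + ‖x‖)) (x : Euc d) (y : Fin N → Euc d) {n : ℕ} (hn : n ≤ N) :
    ‖eulerGrid T N μ x y n‖ ≤ eulerGrowthBound C T N n x y := by
  set G := eulerGrid T N μ x y with hG
  set S := (Finset.range (n + 1)).sup' Finset.nonempty_range_add_one
      (fun m => ‖∑ k ∈ Finset.univ.filter (fun k : Fin N => (k : ℕ) < m), y k‖) with hS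
  set A := ‖x‖ + C * gridTime T N n + S with hA
  set c := C * (T / N) with hc
  have hc0 : 0 ≤ c := by positivity
  have hSm : ∀ m ≤ n, ‖∑ k ∈ Finset.univ.filter (fun k : Fin N => (k : ℕ) < m), y k‖ ≤ S :=
    fun m hm => Finset.le_sup' (fun m =>
      ‖∑ k ∈ Finset.univ.filter (fun k : Fin N => (k : ℕ) < m), y k‖)
      (Finset.mem_range.2 (by omega))
  have hA0 : 0 ≤ A := by
    have : 0 ≤ S := (norm_nonneg _).trans (hSm n le_rfl)
    have : 0 ≤ gridTime T N n := by unfold gridTime; positivity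
    positivity
  have hstep : ∀ j ≤ n, ‖G j‖ ≤ A + c * ∑ k ∈ Finset.range j, ‖G k‖ := by
    intro j hj
    have h1 : ‖∑ k ∈ Finset.range j, (T / N) • μ (G k)‖ ≤
        ∑ k ∈ Finset.range j, (c + c * ‖G k‖) := by
      refine norm_sum_le_of_le _ fun k _ => ?_
      rw [norm_smul, Real.norm_of_nonneg (by positivity)]
      calc T / N * ‖μ (G k)‖ ≤ T / N * (C * (1 + ‖G k‖)) := by gcongr; exact hμ _
        _ = _ := by rw [hc]; ring
    rw [Finset.sum_add_distrib] at h1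
    have h2 : ∑ k ∈ Finset.range j, c ≤ C * gridTime T N n := by
      rw [Finset.sum_const, Finset.card_range, nsmul_eq_mul, hc]
      unfold gridTime
      have : (j : ℝ) ≤ n := by exact_mod_cast hj
      calc (j : ℝ) * (C * (T / N)) ≤ n * (C * (T / N)) := by gcongr
        _ = _ := by ring
    have h3 := hSm j hj
    rw [hG, eulerGrid_eq_sum x y (hj.trans hn), ← hG]
    refine (norm_add₃_le).trans ?_
    rw [hA, Finset.mul_sum]
    linarith
  have hsum : ∀ j, j ≤ n → A + c * ∑ k ∈ Finset.range j, ‖G k‖ ≤ A * (1 + c) ^ j := by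
    intro j
    induction j with
    | zero => simp
    | succ j ih =>
      intro hj
      have i := ih (by omega)
      have s := (hstep j (by omega)).trans i
      rw [Finset.sum_range_succ, pow_succ]
      have := mul_le_mul_of_nonneg_left s hc0
      linarith
  refine ((hstep n le_rfl).trans (hsum n le_rfl)).trans ?_
  unfold eulerGrowthBound
  rw [← hS, ← hA]
  gcongr
  calc (1 + c) ^ n ≤ Real.exp c ^ n := by
        gcongr; linarith [Real.add_one_le_exp c]
    _ = Real.exp (C * gridTime T N n) := by
        rw [← Real.exp_nat_mul, hc]; unfold gridTime; congr 1; ring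

end

namespace IsReluNet

variable {V : Type} [AddCommGroup V] [Module ℝ V]

theorem tent_net : IsReluNet 2 1 tent := by
  convert ((relu_affine (LinearMap.id (R := ℝ) (M := ℝ)) 0).const_mul 2).add
    ((relu_affine (LinearMap.id (R := ℝ) (M := ℝ)) (-(1 / 2))).const_mul (-4)) using 2 with x
  simp only [tent, LinearMap.id_apply, add_zero, ← sub_eq_add_neg]
  ring

theorem sqApprox_net_aux (m : ℕ) (α : ℝ) :
    IsReluNet 4 m (fun p : ℝ × ℝ => p.2 + α * sqApprox m p.1) := by
  induction m generalizing α with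
  | zero =>
    exact of_affine 4 (LinearMap.snd ℝ ℝ ℝ + α • LinearMap.fst ℝ ℝ ℝ).toAffineMap
  | succ m ih =>
    have h1 : IsReluNet 4 1 (fun p : ℝ × ℝ => (tent p.1, p.2 + α * p.1)) :=
      (tent_net.comp_linear (LinearMap.fst ℝ ℝ ℝ)).prodMk
        (linear_real (LinearMap.snd ℝ ℝ ℝ + α • LinearMap.fst ℝ ℝ ℝ) 1)
    have h2 := h1.linear_comp ((LinearMap.fst ℝ ℝ ℝ).prod
      (LinearMap.snd ℝ ℝ ℝ - (α / 2) • LinearMap.fst ℝ ℝ ℝ))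
    rw [Nat.add_comm m 1]
    convert (ih (α / 4)).comp h2 using 2 with p
    simp only [Nat.add_comm 1 m, sqApprox, LinearMap.prod_apply, Function.prod_apply,
      LinearMap.sub_apply, LinearMap.smul_apply, LinearMap.fst_apply, LinearMap.snd_apply,
      smul_eq_mul]
    ring

theorem sqApprox_net (m : ℕ) : IsReluNet 4 m (sqApprox m) := by
  convert (sqApprox_net_aux m 1).comp_linear (LinearMap.inl ℝ ℝ ℝ) using 2 with x
  simp

theorem abs_net : IsReluNet 2 1 (fun x : ℝ => |x|) := by
  convert (relu_affine (LinearMap.id (R := ℝ) (M := ℝ)) 0).add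
    (relu_affine (-LinearMap.id (R := ℝ) (M := ℝ)) 0) using 2 with x
  simp only [relu, LinearMap.id_apply, add_zero, LinearMap.neg_apply]
  rcases le_total x 0 with h | h
  · rw [max_eq_right h, max_eq_left (by linarith), abs_of_nonpos h]; ring
  · rw [max_eq_left h, max_eq_right (by linarith), abs_of_nonneg h]; ring

theorem sqApprox_abs_net (m : ℕ) : IsReluNet 4 (1 + m) (fun x => sqApprox m |x|) :=
  (sqApprox_net m).comp (abs_net.mono (by norm_num))

theorem mulApprox_net {f g : V → ℝ} {w₁ w₂ w L : ℕ} (hf : IsReluNet w₁ L f)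
    (hg : IsReluNet w₂ L g) (hw : w₁ + w₂ ≤ w) (hw' : 4 ≤ w) (m : ℕ) :
    IsReluNet (w + w) (L + (1 + m)) (fun x => mulApprox m (f x) (g x)) := by
  have h1 := ((sqApprox_abs_net m).mono hw').comp (((hf.add hg).const_mul (1 / 2)).mono hw)
  have h2 := ((sqApprox_abs_net m).mono hw').comp
    (((hf.add (hg.const_mul (-1))).const_mul (1 / 2)).mono hw)
  convert h1.add (h2.const_mul (-1)) using 2 with x
  simp only [mulApprox]
  ring_nf

theorem clip_net : IsReluNet 2 1 clip := by
  convert ((relu_affine (LinearMap.id (R := ℝ) (M := ℝ)) 1).add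
    ((relu_affine (LinearMap.id (R := ℝ) (M := ℝ)) (-1)).const_mul (-1))).add_const (-1)
    using 2 with x
  simp only [clip, LinearMap.id_apply, ← sub_eq_add_neg]
  ring

theorem hat_net (k : ℕ) : IsReluNet 3 1 (hat k) := by
  convert ((relu_affine (LinearMap.id (R := ℝ) (M := ℝ)) (-k + 1)).add
    ((relu_affine (LinearMap.id (R := ℝ) (M := ℝ)) (-k)).const_mul (-2))).add
    (relu_affine (LinearMap.id (R := ℝ) (M := ℝ)) (-k - 1)) using 2 with x
  simp only [hat, LinearMap.id_apply]
  ring_nf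

theorem smulApprox_net {d : ℕ} (hd : 0 < d) (ε c : ℝ) (m k : ℕ) :
    IsReluNet (d * 12) (2 + m) (fun s : ℝ × Euc d × Euc d =>
      s.2.2 + smulApprox ε m (hat k (s.1 * c)) s.2.1) := by
  refine euc hd fun i => ?_
  have h1 := (hat_net k).comp_linear (c • LinearMap.fst ℝ ℝ (Euc d × Euc d))
  have h2 := clip_net.comp_linear (ε • (coord i).comp ((LinearMap.fst ℝ (Euc d) (Euc d)).comp
    (LinearMap.snd ℝ ℝ (Euc d × Euc d))))
  have h3 := linear_real ((coord i).comp ((LinearMap.snd ℝ (Euc d) (Euc d)).comp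
    (LinearMap.snd ℝ ℝ (Euc d × Euc d)))) (2 + m)
  have h4 := (mulApprox_net h1 h2 (w := 5) (by norm_num) (by norm_num) m).const_mul ε⁻¹
  rw [show 1 + (1 + m) = 2 + m by ring] at h4
  convert h3.add h4 using 2 with s
  simp [smulApprox, mul_comm]

/-- One summand `smulApprox` is added to the accumulator. -/
theorem accumulate_net {d : ℕ} (hd : 0 < d) (ε c : ℝ) (m k : ℕ) :
    IsReluNet (14 * d + 2) (2 + m) (fun s : ℝ × Euc d × Euc d =>
      (s.1, s.2.1, s.2.2 + smulApprox ε m (hat k (s.1 * c)) s.2.1)) :=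
  ((linear_real (LinearMap.fst ℝ ℝ (Euc d × Euc d)) (2 + m)).prodMk
    ((linear_euc hd ((LinearMap.fst ℝ (Euc d) (Euc d)).comp
      (LinearMap.snd ℝ ℝ (Euc d × Euc d))) (2 + m)).prodMk
      (smulApprox_net hd ε c m k))).mono (by omega)

/-- One step of the Euler scheme. -/
theorem euler_step_net {d w H : ℕ} (hd : 0 < d) {μ : Euc d → Euc d} (hμ : IsReluNet w H μ)
    (c : ℝ) (b : Euc d) :
    IsReluNet (w + 4 * d + 2) H (fun s : ℝ × Euc d × Euc d =>
      (s.1, s.2.1 + c • μ s.2.1 + b, s.2.2)) := by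
  let l : ℝ × Euc d × Euc d →ₗ[ℝ] Euc d := (LinearMap.fst ℝ (Euc d) (Euc d)).comp
    (LinearMap.snd ℝ ℝ (Euc d × Euc d))
  let r : ℝ × Euc d × Euc d →ₗ[ℝ] Euc d := (LinearMap.snd ℝ (Euc d) (Euc d)).comp
    (LinearMap.snd ℝ ℝ (Euc d × Euc d))
  exact ((linear_real (LinearMap.fst ℝ ℝ (Euc d × Euc d)) H).prodMk
    ((((linear_euc hd l H).add ((hμ.comp_linear l).const_smul c)).add_const b).prodMk
      (linear_euc hd r H))).mono (by omega)

end IsReluNet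

/-- The sum of the products of the hat functions and the Euler approximations at grid points,
with approximate products. -/
def netApprox {d : ℕ} (ε : ℝ) (m : ℕ) (T : ℝ) (N : ℕ) (μ : Euc d → Euc d) (y : Fin N → Euc d)
    (n : ℕ) (t : ℝ) (x : Euc d) : Euc d :=
  ∑ k ∈ Finset.range n, smulApprox ε m (hat k (t * (N / T))) (eulerGrid T N μ x y k)

theorem isReluNet_state {d w H : ℕ} (hd : 0 < d) {μ : Euc d → Euc d} (hμ : IsReluNet w H μ)
    (ε : ℝ) (m : ℕ) (T : ℝ) (N : ℕ) (y : Fin N → Euc d) (n : ℕ) :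
    IsReluNet (w + 14 * d + 2) (n * (2 + m + H)) (fun v : ℝ × Euc d =>
      (v.1, eulerGrid T N μ v.2 y n, netApprox ε m T N μ y n v.1 v.2)) := by
  induction n with
  | zero =>
    convert IsReluNet.of_affine (w + 14 * d + 2) ((LinearMap.fst ℝ ℝ (Euc d)).prod
      ((LinearMap.snd ℝ ℝ (Euc d)).prod (0 : ℝ × Euc d →ₗ[ℝ] Euc d))).toAffineMap using 1
    · simp
    · ext v <;> simp [netApprox, eulerGrid]
  | succ n ih =>
    have h1 := ((IsReluNet.accumulate_net hd ε (N / T) m n).mono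
      (show _ ≤ w + 14 * d + 2 by omega)).comp ih
    have h2 := ((IsReluNet.euler_step_net hd hμ (T / N) (if h : n < N then y ⟨n, h⟩ else 0)).mono
      (show _ ≤ w + 14 * d + 2 by omega)).comp h1
    rw [show n * (2 + m + H) + (2 + m) + H = (n + 1) * (2 + m + H) by ring] at h2
    simpa only [netApprox, Finset.sum_range_succ, eulerGrid] using h2

theorem isReluNet_netApprox {d w H : ℕ} (hd : 0 < d) {μ : Euc d → Euc d} (hμ : IsReluNet w H μ)
    (ε : ℝ) (m : ℕ) (T : ℝ) (N : ℕ) (y : Fin N → Euc d) :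
    IsReluNet (w + 14 * d + 2) (N * (2 + m + H) + (2 + m)) (fun v : Euc (d + 1) =>
      netApprox ε m T N μ y (N + 1) (v 0) (WithLp.toLp 2 (fun i : Fin d => v i.succ))) := by
  have h1 := ((IsReluNet.accumulate_net hd ε (N / T) m N).mono
      (show _ ≤ w + 14 * d + 2 by omega)).comp (isReluNet_state hd hμ ε m T N y N)
  have h2 := (h1.linear_comp ((LinearMap.snd ℝ (Euc d) (Euc d)).comp
    (LinearMap.snd ℝ ℝ (Euc d × Euc d)))).comp_linear ((IsReluNet.coord (0 : Fin (d + 1))).prod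
      ((WithLp.linearEquiv 2 ℝ (Fin d → ℝ)).symm.toLinearMap.comp
        (LinearMap.pi fun i : Fin d => IsReluNet.coord i.succ)))
  convert h2 using 2 with v
  rw [netApprox, Finset.sum_range_succ]
  rfl

section

variable {d N m : ℕ} {T ε : ℝ} {μ : Euc d → Euc d}

theorem netApprox_eq (hT : 0 < T) (hN : 0 < N) (x : Euc d) (y : Fin N → Euc d)
    {n : ℕ} (hn : n < N) {t : ℝ} (ht : t ∈ Set.Icc (gridTime T N n) (gridTime T N (n + 1))) :
    ∃ l : ℝ, l = t * N / T - n ∧ 0 ≤ l ∧ l ≤ 1 ∧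
      netApprox ε m T N μ y (N + 1) t x = smulApprox ε m (1 - l) (eulerGrid T N μ x y n) +
        smulApprox ε m l (eulerGrid T N μ x y (n + 1)) := by
  have e1 := gridTime_mul_div hT hN n
  have e2 := gridTime_mul_div hT hN (n + 1)
  push_cast at e2
  have h1 : (n : ℝ) ≤ t * N / T := by
    rw [← e1]; gcongr; exact ht.1
  have h2 : t * N / T ≤ n + 1 := by
    rw [← e2]; gcongr; exact ht.2
  refine ⟨_, rfl, by linarith, by linarith, ?_⟩
  rw [netApprox, mul_div_assoc' t]
  rw [Finset.sum_eq_add_of_mem n (n + 1) (by simp; omega) (by simp; omega) (by omega)]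
  · rw [hat_of_mem_right h1 h2, hat_of_mem_left (by push_cast; linarith) (by push_cast; linarith)]
    congr 2
    · ring
    · push_cast; ring
  · rintro k - ⟨hk, hk'⟩
    have : hat k (t * N / T) = 0 := by
      rcases lt_or_gt_of_ne hk with h | h
      · have : (k : ℝ) + 1 ≤ n := by exact_mod_cast h
        exact hat_of_ge (by linarith)
      · have : (n : ℝ) + 2 ≤ k := by exact_mod_cast (show n + 2 ≤ k by omega)
        exact hat_of_le (by linarith)
    rw [this, smulApprox_zero_left]

theorem continuous_netApprox (hμ : Continuous μ) (n : ℕ) (t : ℝ) (x : Euc d) :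
    Continuous fun y : Fin N → Euc d => netApprox ε m T N μ y n t x := by
  unfold netApprox
  exact continuous_finsetSum _ fun k _ =>
    (continuous_smulApprox _ _ _).comp (continuous_eulerGrid hμ x k)

theorem netApprox_congr (hT : 0 < T) (hN : 0 < N) (l : ℕ) {n : ℕ} {t : ℝ}
    (ht : t ≤ gridTime T N n) (x : Euc d) {y z : Fin N → Euc d}
    (h : ∀ k : Fin N, (k : ℕ) < n → y k = z k) :
    netApprox ε m T N μ y l t x = netApprox ε m T N μ z l t x := by
  unfold netApprox
  refine Finset.sum_congr rfl fun k _ => ?_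
  rcases le_or_gt k n with hk | hk
  · rw [eulerGrid_congr x fun j hj => h j (by omega)]
  · have h2 : t * (N / T) ≤ n := by
      rw [← gridTime_mul_div hT hN n, mul_div_assoc]; gcongr
    have h3 : (n : ℝ) + 1 ≤ k := by exact_mod_cast hk
    rw [hat_of_le (by linarith), smulApprox_zero_left, smulApprox_zero_left]

theorem norm_sub_netApprox_le {C q : ℝ} (hC : 0 ≤ C) (hT : 0 < T) (hN : 0 < N) (hε : 0 < ε)
    (hε1 : ε ≤ 1) (hq : 2 ≤ q) (hm : (1 / 4 : ℝ) ^ (m + 1) ≤ ε ^ 2)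
    (hμ : ∀ x, ‖μ x‖ ≤ C * (1 + ‖x‖)) {Y : ℝ → Euc d → (Fin N → Euc d) → Euc d}
    (hY : IsPerturbedEuler T N μ Y) {n : ℕ} (hn : n < N) {t : ℝ}
    (ht : t ∈ Set.Icc (gridTime T N n) (gridTime T N (n + 1))) (x : Euc d) (y : Fin N → Euc d) :
    ‖Y t x y - netApprox ε m T N μ y (N + 1) t x‖ ≤ ε * (2 * √d +
      eulerGrowthBound C T N n x y ^ q + eulerGrowthBound C T N (n + 1) x y ^ q) := by
  obtain ⟨l, hl, hl0, hl1, he⟩ := netApprox_eq (ε := ε) (m := m) (μ := μ) hT hN x y hn ht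
  rw [he, hY.apply_eq hT hN x y hn ht, ← hl, show (n : ℝ) + 1 - t * N / T = 1 - l by rw [hl]; ring]
  have g1 := norm_eulerGrid_le hC hT hμ x y hn.le
  have g2 := norm_eulerGrid_le hC hT hμ x y (show n + 1 ≤ N from hn)
  have h1 := norm_smulApprox_sub_smul_le hε hε1 hq hm
    (abs_le.2 ⟨by linarith, by linarith⟩ : |1 - l| ≤ 1) (eulerGrid T N μ x y n)
  have h2 := norm_smulApprox_sub_smul_le hε hε1 hq hm
    (abs_le.2 ⟨by linarith, by linarith⟩ : |l| ≤ 1) (eulerGrid T N μ x y (n + 1))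
  rw [norm_sub_rev, add_sub_add_comm]
  calc _ ≤ _ := norm_add_le _ _
    _ ≤ (√d * ε + ε * ‖eulerGrid T N μ x y n‖ ^ q) +
        (√d * ε + ε * ‖eulerGrid T N μ x y (n + 1)‖ ^ q) := by gcongr
    _ ≤ (√d * ε + ε * eulerGrowthBound C T N n x y ^ q) +
        (√d * ε + ε * eulerGrowthBound C T N (n + 1) x y ^ q) := by gcongr
    _ = _ := by ring

theorem norm_netApprox_le {C : ℝ} (hC : 0 ≤ C) (hT : 0 < T) (hN : 0 < N) (hd : 0 < d)
    (hε : 0 < ε) (hε1 : ε ≤ 1) (hm : (1 / 4 : ℝ) ^ (m + 1) ≤ ε ^ 2)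
    (hμ : ∀ x, ‖μ x‖ ≤ C * (1 + ‖x‖)) {n : ℕ} (hn : n < N) {t : ℝ}
    (ht : t ∈ Set.Icc (gridTime T N n) (gridTime T N (n + 1))) (x : Euc d) (y : Fin N → Euc d) :
    ‖netApprox ε m T N μ y (N + 1) t x‖ ≤ 6 * √d + 2 * (eulerGrowthBound C T N n x y ^ 2 +
      eulerGrowthBound C T N (n + 1) x y ^ 2) := by
  obtain ⟨l, hl, hl0, hl1, he⟩ := netApprox_eq (ε := ε) (m := m) (μ := μ) hT hN x y hn ht
  rw [he]
  have g1 := norm_eulerGrid_le hC hT hμ x y hn.le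
  have g2 := norm_eulerGrid_le hC hT hμ x y (show n + 1 ≤ N from hn)
  have h1 := norm_smulApprox_le hε hm
    (abs_le.2 ⟨by linarith, by linarith⟩ : |1 - l| ≤ 1) (eulerGrid T N μ x y n)
  have h2 := norm_smulApprox_le hε hm
    (abs_le.2 ⟨by linarith, by linarith⟩ : |l| ≤ 1) (eulerGrid T N μ x y (n + 1))
  have h3 := norm_add_le (smulApprox ε m (1 - l) (eulerGrid T N μ x y n))
    (smulApprox ε m l (eulerGrid T N μ x y (n + 1)))
  have hd1 : 1 ≤ √(d : ℝ) := Real.one_le_sqrt.2 (by exact_mod_cast hd)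
  have h4 : √(d : ℝ) * ε ≤ √d := mul_le_of_le_one_right (by positivity) hε1
  nlinarith [sq_nonneg (eulerGrowthBound C T N n x y - 1),
    sq_nonneg (eulerGrowthBound C T N (n + 1) x y - 1),
    sq_nonneg (eulerGrowthBound C T N n x y), sq_nonneg (eulerGrowthBound C T N (n + 1) x y)]

end

theorem one_div_four_pow_ceil_logb_le {ε : ℝ} (hε : 0 < ε) :
    (1 / 4 : ℝ) ^ (⌈Real.logb 2 ε⁻¹⌉₊ + 1) ≤ ε ^ 2 := by
  set m := ⌈Real.logb 2 ε⁻¹⌉₊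
  have h1 : ε⁻¹ ≤ 2 ^ m := by
    have := Nat.le_ceil (Real.logb 2 ε⁻¹)
    rwa [Real.logb_le_iff_le_rpow (by norm_num) (by positivity), Real.rpow_natCast] at this
  have h2 : (1 / 2 : ℝ) ^ m ≤ ε := by
    rw [one_div, inv_pow]
    exact inv_le_of_inv_le₀ hε h1
  calc (1 / 4 : ℝ) ^ (m + 1) ≤ (1 / 4) ^ m :=
        pow_le_pow_of_le_one (by norm_num) (by norm_num) (Nat.le_succ m)
    _ = ((1 / 2) ^ m) ^ 2 := by rw [← pow_mul, mul_comm, pow_mul]; norm_num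
    _ ≤ ε ^ 2 := by gcongr

theorem depth_constant_ge {ε q D : ℝ} (hε : 0 < ε) (hε1 : ε ≤ 1) (hq : 2 < q)
    (hD : D = (720 * q / (q - 2)) * (Real.logb 2 ε⁻¹ + q + 1) - 504) :
    200 * ((⌈Real.logb 2 ε⁻¹⌉₊ : ℝ) + 2) ≤ D := by
  have hl : 0 ≤ Real.logb 2 ε⁻¹ := Real.logb_nonneg (by norm_num) (one_le_inv₀ hε |>.2 hε1)
  have h1 := (Nat.ceil_lt_add_one hl).le
  have h2 : 720 ≤ 720 * q / (q - 2) := by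
    rw [le_div_iff₀ (by linarith)]; linarith
  have h3 : 720 * (Real.logb 2 ε⁻¹ + 3) ≤
      (720 * q / (q - 2)) * (Real.logb 2 ε⁻¹ + q + 1) := by
    exact mul_le_mul h2 (by linarith) (by linarith) (by linarith)
  rw [hD]
  linarith

theorem params_arith {N d P H m : ℝ} (hN : 1 ≤ N) (hd : 1 ≤ d) (hdP : d ≤ P) (hH : 0 ≤ H)
    (hm : 0 ≤ m) {D : ℝ} (hD : 200 * (m + 2) ≤ D) :
    (N * (2 + m + H) + (2 + m) + 1) * ((P + 14 * d + 2) * (P + 14 * d + 2 + 1)) ≤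
      9 / 2 * N ^ 6 * d ^ 16 * (2 * H + D + (30 + 6 * H + (4 + P) ^ 2) ^ 2) ^ 2 := by
  have hP : 1 ≤ P := hd.trans hdP
  have hN6 : N ≤ N ^ 6 := le_self_pow₀ hN (by norm_num)
  have hd16 : 1 ≤ d ^ 16 := one_le_pow₀ hd
  have hw : (P + 14 * d + 2) * (P + 14 * d + 2 + 1) ≤ (17 * P) * (18 * P) := by
    gcongr <;> linarith
  have hL : N * (2 + m + H) + (2 + m) + 1 ≤ N * (3 * (2 + m) + H) := by nlinarith
  have hY : 9 * P ^ 2 ≤ (30 + 6 * H + (4 + P) ^ 2) ^ 2 := by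
    have : 3 * P ≤ 30 + 6 * H + (4 + P) ^ 2 := by nlinarith
    calc 9 * P ^ 2 = (3 * P) ^ 2 := by ring
      _ ≤ _ := by gcongr
  set X := 2 * H + D
  set Z := (30 + 6 * H + (4 + P) ^ 2) ^ 2
  have hX : 2 * (3 * (2 + m) + H) ≤ X := by linarith
  calc (N * (2 + m + H) + (2 + m) + 1) * ((P + 14 * d + 2) * (P + 14 * d + 2 + 1))
      ≤ (N * (3 * (2 + m) + H)) * ((17 * P) * (18 * P)) := by gcongr
    _ = 17 * N * (2 * (3 * (2 + m) + H)) * (9 * P ^ 2) := by ring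
    _ ≤ 18 * N * X * Z := by
        have hX0 : 0 ≤ X := le_trans (by positivity) hX
        gcongr
        norm_num
    _ ≤ 9 / 2 * N * 1 * (X + Z) ^ 2 := by
        have := mul_nonneg (zero_le_one.trans hN) (sq_nonneg (X - Z))
        linarith
    _ ≤ 9 / 2 * N ^ 6 * d ^ 16 * (X + Z) ^ 2 := by gcongr

end

theorem mainTheorem2 (N d : ℕ) (hN : 0 < N) (hd : 0 < d)
    (C T D ε q : ℝ) (hC : 0 ≤ C) (hT : 0 < T) (hε : 0 < ε) (hε1 : ε ≤ 1) (hq : 2 < q)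
    (hD : D = (720 * q / (q - 2)) * (Real.logb 2 ε⁻¹ + q + 1) - 504)
    (Φ : ANN d d) (hΦ : ∀ x : Euc d, ‖Φ.realize relu x‖ ≤ C * (1 + ‖x‖))
    (Y : ℝ → Euc d → (Fin N → Euc d) → Euc d)
    (hY : IsPerturbedEuler T N (Φ.realize relu) Y) :
    ∃ Ψ : (Fin N → Euc d) → ANN (d + 1) d,
      (∀ y, Continuous ((Ψ y).realize relu)) ∧
      (∀ n : ℕ, n < N → ∀ t ∈ Set.Icc (gridTime T N n) (gridTime T N (n + 1)), ∀ x y,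
        ‖Y t x y - (Ψ y).realize relu (timeSpace t x)‖ ≤
          ε * (2 * Real.sqrt d + eulerGrowthBound C T N n x y ^ q
            + eulerGrowthBound C T N (n + 1) x y ^ q)) ∧
      (∀ n : ℕ, n < N → ∀ t ∈ Set.Icc (gridTime T N n) (gridTime T N (n + 1)), ∀ x y,
        ‖(Ψ y).realize relu (timeSpace t x)‖ ≤
          6 * Real.sqrt d + 2 * (eulerGrowthBound C T N n x y ^ 2
            + eulerGrowthBound C T N (n + 1) x y ^ 2)) ∧
      (∀ y, ((Ψ y).params : ℝ) ≤
        9 / 2 * (N : ℝ) ^ 6 * (d : ℝ) ^ 16 *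
          (2 * (Φ.hiddenLayers : ℝ) + D
            + (30 + 6 * (Φ.hiddenLayers : ℝ) + (4 + (Φ.params : ℝ)) ^ 2) ^ 2) ^ 2) ∧
      (∀ t ∈ Set.Icc 0 T, ∀ x,
        Continuous (fun y => (Ψ y).realize relu (timeSpace t x))) ∧
      (∀ n : ℕ, n ≤ N → ∀ t ∈ Set.Icc 0 (gridTime T N n), ∀ x, ∀ y z : Fin N → Euc d,
        (∀ k : Fin N, (k : ℕ) < n → y k = z k) →
        (Ψ y).realize relu (timeSpace t x) = (Ψ z).realize relu (timeSpace t x)) := by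
  set P := Φ.params with hP
  set H := Φ.hiddenLayers with hH
  set m := ⌈Real.logb 2 ε⁻¹⌉₊ with hm
  have hm' := one_div_four_pow_ceil_logb_le hε
  choose Ψ hΨ hΨP using fun y : Fin N → Euc d => IsReluNet.exists_ann (Nat.succ_pos d) hd
    (by omega) (by omega) (isReluNet_netApprox hd Φ.isReluNet ε m T N y)
  have hreal : ∀ y t x, (Ψ y).realize relu (timeSpace t x) =
      netApprox ε m T N (Φ.realize relu) y (N + 1) t x := by
    intro y t x
    simp only [hΨ, timeSpace, Fin.cons_zero, Fin.cons_succ]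
  refine ⟨Ψ, fun y => (Ψ y).continuous_realize, ?_, ?_, fun y => ?_, ?_, ?_⟩
  · intro n hn t ht x y
    rw [hreal]
    exact norm_sub_netApprox_le hC hT hN hε hε1 hq.le hm' hΦ hY hn ht x y
  · intro n hn t ht x y
    rw [hreal]
    exact norm_netApprox_le hC hT hN hd hε hε1 hm' hΦ hn ht x y
  · have h1 : (1 : ℝ) ≤ N := by exact_mod_cast hN
    have h2 : (1 : ℝ) ≤ d := by exact_mod_cast hd
    have h3 : (d : ℝ) ≤ P := by exact_mod_cast Φ.params_ge_output
    refine le_trans ?_ (params_arith h1 h2 h3 (Nat.cast_nonneg H) (Nat.cast_nonneg m)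
      (depth_constant_ge hε hε1 hq hD))
    exact_mod_cast hΨP y
  · intro t ht x
    simp only [hreal]
    exact continuous_netApprox Φ.continuous_realize _ _ _
  · intro n hn t ht x y z hyz
    rw [hreal, hreal]
    exact netApprox_congr hT hN _ ht.2 x hyz
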